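/- **Setting.** Let $\mathcal X$ (inputs) and $\mathcal F$ (semantic features) be measurable spaces, $\phi:\mathcal X\to\mathcal F$ a measurable feature map, and $\mathcal Y=\{0,1\}$. For each domain $\omega\in\Omega$ let $P_\omega$ be a probability distribution on $\mathcal X\times\mathcal Y$, and let $P(\mathbf h_{\rm sem}\mid\omega)$ be the law of $\phi(\mathbf x)$ for $(\mathbf x,y)\sim P_\omega$. Let $\pi$ be a discrete probability distribution on $\Omega$ and $\bar P=\sum_{\omega\in\Omega}\pi(\omega)P(\mathbf h_{\rm sem}\mid\omega)$. Let $\mathcal H$ be a class of measurable classifiers $h:\mathcal F\to\{0,1\}$ of finite VC dimension $d_{VC}$ (the largest size of a finite set on which $\mathcal H$ realizes all labellings). Write $\mathcal R_\omega(h)=P_\omega\big(h(\phi(\mathbf x))\ne y\big)$, and for a sample $(\mathbf x_i,y_i)_{i\le N}$ write $\mathcal R_{\rm emp}(h)=\frac1N\#\{i\le N: h(\phi(\mathbf x_i))\neq y_i\}$. **Theorem.** Let $\delta\ge 0$ and suppose that $$\sup_{\omega\in\Omega} D_{KL}\big(P(\mathbf h_{\rm sem}\mid\omega)\,\|\,\bar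 P\big)\le\delta .$$ Let $\omega_s,\omega_t\in\Omega$ be a source and a target domain, $N\ge1$, $\eta\in(0,1)$, and $\lambda^*=\inf_{h^*\in\mathcal H}\big[\mathcal R_{\omega_s}(h^*)+\mathcal R_{\omega_t}(h^*)\big]$. Consider, for $h\in\mathcal H$ and $N$ i.i.d. samples from $P_{\omega_s}$, the bound $$\mathcal R_{\omega_t}(h)\le \mathcal R_{\rm emp}(h)+\sqrt{\frac{2d_{VC}\log(2N/d_{VC})+2\log(4/\eta)}{N}}+\sqrt{2\delta}+\lambda^*,\qquad(*)$$ where $d_{VC}\log(2N/d_{VC})$ is read as $0$ if $d_{VC}=0$. 1. If $d_{VC}\le 2N$, then for each fixed $h\in\mathcal H$ the bound $(*)$ holds with probability at least $1-\eta$. 2. If $d_{VC}\le N$ and $\mathcal H$ is pointwise separable (there is a countable $\mathcal C\subseteq\mathcal H$ such that each $h\in\mathcal H$ is the pointwise limit of a sequence in $\mathcal C$), then with probability at least $1-\eta$ the bound $(*)$ holds simultaneously for all $h\in\mathcal H$. -/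

import Mathlib

open MeasureTheory

open scoped ENNReal NNReal

namespace DomainShift

/-- The class `H` of binary classifiers shatters the finite set `A`: every labelling of `A` is
realised on `A` by a member of `H`. -/
def Shatters {F : Type*} (H : Set (F → Bool)) (A : Finset F) : Prop :=
  ∀ f : F → Bool, ∃ h ∈ H, ∀ v ∈ A, h v = f v

/-- The Vapnik-Chervonenkis dimension of a class of binary classifiers: the supremum of the
cardinalities of the finite sets that it shatters. -/
noncomputable def vcDim {F : Type*} (H : Set (F → Bool)) : ℕ∞ :=
  ⨆ (A : Finset F) (_ : Shatters H A), (A.card : ℕ∞)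

/-- `H` has a countable subclass such that each member of `H` is a pointwise limit of a sequence
in the subclass (labels are discrete, so convergence at a point means being eventually equal). -/
def PointwiseSeparable {F : Type*} (H : Set (F → Bool)) : Prop :=
  ∃ C ⊆ H, C.Countable ∧ ∀ h ∈ H, ∃ g : ℕ → F → Bool,
    (∀ n, g n ∈ C) ∧ ∀ v, ∀ᶠ n in Filter.atTop, g n v = h v

/-- The law of the semantic features `φ x` when `(x, y)` is drawn from `Q`. -/
noncomputable def featureLaw {X F : Type*} [MeasurableSpace X] [MeasurableSpace F]
    (φ : X → F) (Q : Measure (X × Bool)) : Measure F :=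
  Q.map (fun z => φ z.1)

/-- The mixture `∑ ω, π ω · P(features | ω)` of the domain-conditional feature laws. -/
noncomputable def featureMixture {Ω X F : Type*} [MeasurableSpace X] [MeasurableSpace F]
    (φ : X → F) (P : Ω → Measure (X × Bool)) (π : PMF Ω) : Measure F :=
  Measure.sum fun ω => π ω • featureLaw φ (P ω)

/-- The 0-1 risk under `Q` of the classifier `h` acting on the semantic features. -/
noncomputable def risk {X F : Type*} [MeasurableSpace X]
    (φ : X → F) (Q : Measure (X × Bool)) (h : F → Bool) : ℝ :=
  Q.real {z | h (φ z.1) ≠ z.2}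

/-- The empirical 0-1 risk on the sample `S`. -/
noncomputable def empRisk {X F : Type*} {N : ℕ}
    (φ : X → F) (S : Fin N → X × Bool) (h : F → Bool) : ℝ :=
  (∑ i, if h (φ (S i).1) ≠ (S i).2 then (1 : ℝ) else 0) / N

/-- The optimal combined error of the class `H` on a source and a target distribution. -/
noncomputable def optJointRisk {X F : Type*} [MeasurableSpace X]
    (φ : X → F) (Qs Qt : Measure (X × Bool)) (H : Set (F → Bool)) : ℝ :=
  ⨅ h : H, (risk φ Qs h + risk φ Qt h)

/-- The complexity term. For `d = 0` the product `d * log (2N/d)` is `0`. -/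
noncomputable def vcTerm (d N : ℕ) (η : ℝ) : ℝ :=
  Real.sqrt ((2 * d * Real.log (2 * N / d) + 2 * Real.log (4 / η)) / N)

end DomainShift

/-!
The risk on the target domain is first compared with the risk on the source domain, and the latter
with the empirical risk.

*Change of domain.* For `g` in the class, the triangle inequality bounds the target risk of `h` by
the target risk of `g` plus the target probability of the feature event `h ≠ g`. By Pinsker's
inequality, applied to the source law and the mixture and to the mixture and the target law, this
probability moves by at most `2 √(δ/2) = √(2δ)` when the target is replaced by the source; under
the source it is at most the sum of the two risks. Taking the infimum over `g` gives
`risk_target_le`. Pinsker's inequality (`abs_measureReal_sub_le_sqrt_klDiv`) follows from the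
variational bound `∫ u ∂μ ≤ KL(μ ‖ ν)` for `∫ exp u ∂ν ≤ 1` together with Hoeffding's lemma.

*Concentration.* Let `ε = vcTerm d N η`, so that `N ε² = 2 d log (2N/d) + 2 log (4/η)`. For one
classifier the claim is Hoeffding's inequality. Uniformly over the class, pointwise separability
reduces the claim to a countable subclass, on which a symmetrization argument is run. The textbook
version, with a ghost sample of the same size as the sample, is too weak here: its exponential
factor is at best `exp (-N ε² / 2) = (η / 4) (d/2N)^d`, whereas Sauer's bound for the number of
labellings of `2N` points is `(2eN/d)^d`. The ghost sample therefore consists of `7` points for each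
of the `N` sample points.

* A deviation `ε` of the sample from the mean forces, with conditional probability at least `1/4`,
  a deviation `7/8 · ε` of the sample from the ghost sample, hence a deviation `(7/8)² ε` of the
  sample from the average over all `8N` points (`measureReal_exists_deviation_le_ghost`).
* The joint law is invariant under permutations inside the `N` blocks of `8` points, so the sample
  may be replaced by a uniformly random choice of one point from each block. Conditionally on the
  points, Hoeffding's inequality and a union bound over the at most `(8eN/d)^d` traces of the class
  give `(8eN/d)^d exp (-2N (49/64)² ε²)` (`measureReal_exists_block_deviation_le`).

The coefficient `2 (49/64)² ≈ 1.17` leaves a gain of `exp (-0.67 N ε²)` over the factor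
`exp (-N ε² / 2)`, which alone would cancel `4 (2N/d)^d / η` exactly. If `ε < 1` (otherwise there is
nothing to prove) then `log (2N/d) ≥ 2`, so `N ε² ≥ 4d`, and this gain absorbs the remaining
`(4e)^d` (`vc_tail_le`).
-/

namespace DomainShift

open ProbabilityTheory InformationTheory

/-! ### Pinsker's inequality -/

/-- The Fenchel–Young inequality for `klFun`, whose convex conjugate is `u ↦ exp u - 1`. -/
theorem mul_le_klFun_add_exp_sub_one {x : ℝ} (hx : 0 ≤ x) (u : ℝ) :
    x * u ≤ klFun x + Real.exp u - 1 := by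
  rw [klFun_apply]
  rcases hx.eq_or_lt with rfl | hx
  · simpa using (Real.exp_pos u).le
  · have h := Real.add_one_le_exp (u - Real.log x)
    rw [Real.exp_sub, Real.exp_log hx, le_div_iff₀ hx] at h
    linarith

/-- A variational lower bound for the Kullback–Leibler divergence, in the spirit of Donsker and
Varadhan: the Fenchel–Young inequality at the density of `μ`, integrated against `ν`. -/
theorem integral_le_toReal_klDiv_of_integral_exp_le_one {α : Type*} [MeasurableSpace α]
    {μ ν : Measure α} [IsFiniteMeasure μ] [IsProbabilityMeasure ν] (hKL : klDiv μ ν ≠ ∞)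
    {u : α → ℝ} (hu : Measurable u) {M : ℝ} (hM : ∀ x, |u x| ≤ M)
    (hexp : ∫ x, Real.exp (u x) ∂ν ≤ 1) :
    ∫ x, u x ∂μ ≤ (klDiv μ ν).toReal := by
  obtain ⟨hac, hllr⟩ := klDiv_ne_top_iff.1 hKL
  have hint_exp : Integrable (fun x => Real.exp (u x)) ν :=
    Integrable.of_bound (by fun_prop) (Real.exp M)
      (ae_of_all _ fun x => by
        rw [Real.norm_of_nonneg (Real.exp_pos _).le]
        exact Real.exp_le_exp.2 ((le_abs_self _).trans (hM x)))
  have hint_exp' : Integrable (fun x => Real.exp (u x) - 1) ν := hint_exp.sub (integrable_const 1)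
  have hint_kl := (integrable_klFun_rnDeriv_iff hac).2 hllr
  have hint_u : Integrable u μ := Integrable.of_bound (by fun_prop) M (ae_of_all _ hM)
  have hint_fu : Integrable (fun x => (μ.rnDeriv ν x).toReal * u x) ν := by
    simpa using (integrable_rnDeriv_smul_iff hac).2 hint_u
  calc ∫ x, u x ∂μ = ∫ x, (μ.rnDeriv ν x).toReal * u x ∂ν := by
        simpa using (integral_rnDeriv_smul hac (f := u)).symm
    _ ≤ ∫ x, (klFun (μ.rnDeriv ν x).toReal + (Real.exp (u x) - 1)) ∂ν :=
        integral_mono hint_fu (hint_kl.add hint_exp') fun x => by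
          have := mul_le_klFun_add_exp_sub_one (x := (μ.rnDeriv ν x).toReal)
            ENNReal.toReal_nonneg (u x)
          simp only; linarith
    _ ≤ (klDiv μ ν).toReal := by
        rw [integral_add hint_kl hint_exp',
          integral_sub hint_exp (integrable_const 1), toReal_klDiv_eq_integral_klFun hac]
        simpa using hexp

/-- Pinsker's inequality for the probability of a single event. The variational bound is applied to
`u = l (1_A - ν A) - l² / 8`, which is admissible by Hoeffding's lemma. -/
theorem abs_measureReal_sub_le_sqrt_klDiv {α : Type*} [MeasurableSpace α] {μ ν : Measure α}
    [IsProbabilityMeasure μ] [IsProbabilityMeasure ν] {δ : ℝ≥0} (hKL : klDiv μ ν ≤ δ)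
    {A : Set α} (hA : MeasurableSet A) :
    |μ.real A - ν.real A| ≤ Real.sqrt (δ / 2) := by
  have hne : klDiv μ ν ≠ ∞ := ne_top_of_le_ne_top ENNReal.coe_ne_top hKL
  have hkl : (klDiv μ ν).toReal ≤ δ := by simpa using ENNReal.toReal_mono ENNReal.coe_ne_top hKL
  have key (l : ℝ) : l * (μ.real A - ν.real A) - l ^ 2 / 8 ≤ δ := by
    set X : α → ℝ := A.indicator 1 with hX
    have hXm : Measurable X := measurable_one.indicator hA
    have hX01 : ∀ x, X x ∈ Set.Icc (0 : ℝ) 1 := fun x => by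
      by_cases hx : x ∈ A <;> simp [hX, hx]
    have hEν : ∫ x, X x ∂ν = ν.real A := integral_indicator_one hA
    have hEμ : ∫ x, X x ∂μ = μ.real A := integral_indicator_one hA
    have hsub := hasSubgaussianMGF_of_mem_Icc (μ := ν) hXm.aemeasurable (ae_of_all _ hX01)
    have hmgf := hsub.mgf_le l
    rw [mgf, hEν] at hmgf
    refine le_trans ?_ ((integral_le_toReal_klDiv_of_integral_exp_le_one hne
      (u := fun x => l * (X x - ν.real A) - l ^ 2 / 8) (by fun_prop)
      (M := |l| + l ^ 2 / 8) (fun x => ?_) ?_).trans hkl)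
    · have hXi : Integrable X μ := (integrable_const (1 : ℝ)).indicator hA
      rw [integral_sub (by fun_prop) (by fun_prop), integral_const_mul,
        integral_sub hXi (by fun_prop), hEμ]
      simp
    · have h1 : |X x - ν.real A| ≤ 1 := by
        have := hX01 x
        have h0 : 0 ≤ ν.real A := measureReal_nonneg
        have h1 : ν.real A ≤ 1 := measureReal_le_one
        rw [abs_le]; constructor <;> linarith [this.1, this.2]
      calc |l * (X x - ν.real A) - l ^ 2 / 8| ≤ |l * (X x - ν.real A)| + |l ^ 2 / 8| := abs_sub _ _
        _ ≤ |l| + l ^ 2 / 8 := by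
          rw [abs_mul, abs_of_nonneg (by positivity : 0 ≤ l ^ 2 / 8)]
          gcongr
          exact mul_le_of_le_one_right (abs_nonneg l) h1
    · simp_rw [sub_eq_add_neg (_ * _), Real.exp_add]
      rw [integral_mul_const, Real.exp_neg, ← div_eq_mul_inv, div_le_one (Real.exp_pos _)]
      refine hmgf.trans (le_of_eq ?_)
      congr 1
      norm_num
      ring
  apply Real.abs_le_sqrt
  -- `l = 4 (μ A - ν A)` is optimal
  linarith [key (4 * (μ.real A - ν.real A))]

/-! ### The change of domain -/

theorem isProbabilityMeasure_featureLaw {X F : Type*} [MeasurableSpace X] [MeasurableSpace F]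
    {φ : X → F} (hφ : Measurable φ) (Q : Measure (X × Bool)) [IsProbabilityMeasure Q] :
    IsProbabilityMeasure (featureLaw φ Q) :=
  Measure.isProbabilityMeasure_map (hφ.comp measurable_fst).aemeasurable

theorem isProbabilityMeasure_featureMixture {Ω X F : Type*} [MeasurableSpace X]
    [MeasurableSpace F] {φ : X → F} (hφ : Measurable φ) (P : Ω → Measure (X × Bool))
    [∀ ω, IsProbabilityMeasure (P ω)] (π : PMF Ω) :
    IsProbabilityMeasure (featureMixture φ P π) := by
  have (ω : Ω) := isProbabilityMeasure_featureLaw hφ (P ω)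
  constructor
  rw [featureMixture, Measure.sum_apply _ MeasurableSet.univ]
  simp

/-- Two domains are compared through the mixture, at the cost of Pinsker's inequality twice. -/
theorem featureLaw_real_le_add_sqrt {Ω X F : Type*} [MeasurableSpace X] [MeasurableSpace F]
    {φ : X → F} (hφ : Measurable φ) (P : Ω → Measure (X × Bool))
    [∀ ω, IsProbabilityMeasure (P ω)] (π : PMF Ω) {δ : ℝ≥0}
    (hδ : (⨆ ω, klDiv (featureLaw φ (P ω)) (featureMixture φ P π)) ≤ (δ : ℝ≥0∞))
    (ωs ωt : Ω) {A : Set F} (hA : MeasurableSet A) :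
    (featureLaw φ (P ωt)).real A ≤ (featureLaw φ (P ωs)).real A + Real.sqrt (2 * δ) := by
  have (ω : Ω) := isProbabilityMeasure_featureLaw hφ (P ω)
  have := isProbabilityMeasure_featureMixture hφ P π
  have hs := abs_measureReal_sub_le_sqrt_klDiv ((iSup_le_iff.1 hδ) ωs) hA
  have ht := abs_measureReal_sub_le_sqrt_klDiv ((iSup_le_iff.1 hδ) ωt) hA
  have h2 : Real.sqrt (2 * δ) = 2 * Real.sqrt (δ / 2) := by
    rw [show (2 * δ : ℝ) = 2 ^ 2 * (δ / 2) by ring, Real.sqrt_mul (by positivity),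
      Real.sqrt_sq (by norm_num)]
  linarith [(abs_le.1 hs).1, (abs_le.1 ht).2]

theorem measurableSet_ne_label {X F : Type*} [MeasurableSpace X] [MeasurableSpace F]
    {φ : X → F} (hφ : Measurable φ) {h : F → Bool} (hh : Measurable h) :
    MeasurableSet {z : X × Bool | h (φ z.1) ≠ z.2} :=
  (measurableSet_eq_fun ((hh.comp hφ).comp measurable_fst) measurable_snd).compl

theorem risk_nonneg {X F : Type*} [MeasurableSpace X] (φ : X → F) (Q : Measure (X × Bool))
    (h : F → Bool) : 0 ≤ risk φ Q h := measureReal_nonneg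

theorem risk_le_one {X F : Type*} [MeasurableSpace X] (φ : X → F) (Q : Measure (X × Bool))
    [IsProbabilityMeasure Q] (h : F → Bool) : risk φ Q h ≤ 1 := measureReal_le_one

/-- The change of domain: the target risk exceeds the source risk by at most `√(2δ)` plus the
optimal joint risk. -/
theorem risk_target_le {Ω X F : Type*} [MeasurableSpace X] [MeasurableSpace F]
    {φ : X → F} (hφ : Measurable φ) (P : Ω → Measure (X × Bool))
    [∀ ω, IsProbabilityMeasure (P ω)] (π : PMF Ω) {δ : ℝ≥0}
    (hδ : (⨆ ω, klDiv (featureLaw φ (P ω)) (featureMixture φ P π)) ≤ (δ : ℝ≥0∞))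
    {H : Set (F → Bool)} (hH : ∀ h ∈ H, Measurable h) (ωs ωt : Ω) {h : F → Bool} (hh : h ∈ H) :
    risk φ (P ωt) h ≤ risk φ (P ωs) h + Real.sqrt (2 * δ)
      + optJointRisk φ (P ωs) (P ωt) H := by
  have : Nonempty H := ⟨⟨h, hh⟩⟩
  suffices hg : ∀ g : H, risk φ (P ωt) h - risk φ (P ωs) h - Real.sqrt (2 * δ)
      ≤ risk φ (P ωs) g + risk φ (P ωt) g by
    have := le_ciInf hg
    rw [optJointRisk]; linarith
  rintro ⟨g, hgH⟩
  have hA : MeasurableSet {v | h v ≠ g v} := (measurableSet_eq_fun (hH h hh) (hH g hgH)).compl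
  have hdis (ω : Ω) : (featureLaw φ (P ω)).real {v | h v ≠ g v}
      = (P ω).real {z | h (φ z.1) ≠ g (φ z.1)} :=
    map_measureReal_apply (hφ.comp measurable_fst) hA
  have hshift := featureLaw_real_le_add_sqrt hφ P π hδ ωs ωt hA
  rw [hdis, hdis] at hshift
  have ht : risk φ (P ωt) h ≤ risk φ (P ωt) g + (P ωt).real {z | h (φ z.1) ≠ g (φ z.1)} := by
    refine (measureReal_mono (fun z hz => ?_)).trans (measureReal_union_le _ _)
    by_cases hgz : g (φ z.1) = z.2
    · exact Or.inr fun h' => hz (h'.trans hgz)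
    · exact Or.inl hgz
  have hs : (P ωs).real {z | h (φ z.1) ≠ g (φ z.1)} ≤ risk φ (P ωs) h + risk φ (P ωs) g := by
    refine (measureReal_mono (fun z hz => ?_)).trans (measureReal_union_le _ _)
    by_cases hhz : h (φ z.1) = z.2
    · exact Or.inr fun h' => hz (hhz.trans h'.symm)
    · exact Or.inl hhz
  simp only
  linarith

/-! ### Hoeffding's inequality on product spaces -/

/-- Hoeffding's inequality for the lower deviations of `[0, 1]`-valued functions of the coordinates
of a product space, where functions and laws may depend on the coordinate. -/
theorem measureReal_pi_le_exp_of_mem_Icc {ι : Type*} [Fintype ι] {E : ι → Type*}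
    [∀ i, MeasurableSpace (E i)] (ν : ∀ i, Measure (E i)) [∀ i, IsProbabilityMeasure (ν i)]
    {f : ∀ i, E i → ℝ} (hf : ∀ i, Measurable (f i)) (h01 : ∀ i x, f i x ∈ Set.Icc (0 : ℝ) 1)
    {t : ℝ} (ht : 0 ≤ t) :
    (Measure.pi ν).real {x | Fintype.card ι * t ≤ ∑ i, (∫ y, f i y ∂ν i - f i (x i))}
      ≤ Real.exp (-2 * Fintype.card ι * t ^ 2) := by
  have hind : iIndepFun (fun i (x : ∀ i, E i) => ∫ y, f i y ∂ν i - f i (x i)) (Measure.pi ν) :=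
    iIndepFun_pi (X := fun i z => ∫ y, f i y ∂ν i - f i z)
      fun i => (measurable_const.sub (hf i)).aemeasurable
  -- `1 / 4` is the variance proxy that Hoeffding's lemma gives for an interval of length `1`
  have hsub (i : ι) : HasSubgaussianMGF (fun x : ∀ i, E i => ∫ y, f i y ∂ν i - f i (x i))
      ((‖(1 : ℝ) - 0‖₊ / 2) ^ 2) (Measure.pi ν) := by
    have h := (hasSubgaussianMGF_of_mem_Icc (hf i).aemeasurable
      (ae_of_all (ν i) (h01 i))).neg
    rw [← (measurePreserving_eval ν i).map_eq] at h
    have h' := h.of_map (Y := Function.eval i) (measurable_pi_apply i).aemeasurable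
    rw [(measurePreserving_eval ν i).map_eq] at h'
    refine h'.congr (ae_of_all _ fun x => ?_)
    simp
  have h := HasSubgaussianMGF.measure_sum_ge_le_of_iIndepFun hind (s := Finset.univ)
    (fun i _ => hsub i) (ε := Fintype.card ι * t) (by positivity)
  refine h.trans (Real.exp_le_exp.2 (le_of_eq ?_))
  rcases (Nat.eq_zero_or_pos (Fintype.card ι)) with h0 | h0
  · simp [h0]
  · have : (0 : ℝ) < Fintype.card ι := by exact_mod_cast h0
    simp
    field_simp

/-! ### The Sauer–Shelah bound for classes of classifiers -/

/-- The bound `(e m / d) ^ d` for the number of subsets of size at most `d`. For `d = 0` the junk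
value of `m / d` is harmless, as it is raised to the power `0`. -/
theorem sum_choose_le_exp_mul_div_pow {d m : ℕ} (hdm : d ≤ m) :
    ((∑ k ∈ Finset.Iic d, m.choose k : ℕ) : ℝ) ≤ Real.exp d * ((m : ℝ) / d) ^ d := by
  rcases Nat.eq_zero_or_pos d with rfl | hd
  · have : Finset.Iic 0 = ({0} : Finset ℕ) := by ext; simp
    simp [this]
  have hd' : (0 : ℝ) < d := by exact_mod_cast hd
  have hm' : (0 : ℝ) < m := by exact_mod_cast hd.trans_le hdm
  have hx1 : (d : ℝ) / m ≤ 1 := (div_le_one hm').2 (by exact_mod_cast hdm)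
  have hx0 : (0 : ℝ) < d / m := by positivity
  -- the factor `(d / m) ^ d` is at most `(d / m) ^ k`, and the binomial theorem applies
  have key : ((∑ k ∈ Finset.Iic d, m.choose k : ℕ) : ℝ) * ((d : ℝ) / m) ^ d ≤ Real.exp d := by
    calc ((∑ k ∈ Finset.Iic d, m.choose k : ℕ) : ℝ) * ((d : ℝ) / m) ^ d
        ≤ ∑ k ∈ Finset.Iic d, ((d : ℝ) / m) ^ k * m.choose k := by
          push_cast
          rw [Finset.sum_mul]
          refine Finset.sum_le_sum fun k hk => ?_
          rw [mul_comm]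
          gcongr ?_ * _
          exact pow_le_pow_of_le_one hx0.le hx1 (Finset.mem_Iic.1 hk)
      _ ≤ ∑ k ∈ Finset.range (m + 1), ((d : ℝ) / m) ^ k * m.choose k := by
          refine Finset.sum_le_sum_of_subset_of_nonneg (fun k hk => ?_)
            fun _ _ _ => by positivity
          have := Finset.mem_Iic.1 hk
          exact Finset.mem_range.2 (by omega)
      _ = ((d : ℝ) / m + 1) ^ m := by rw [add_pow]; simp
      _ ≤ Real.exp (d / m) ^ m := by gcongr; exact Real.add_one_le_exp _
      _ = Real.exp d := by rw [← Real.exp_nat_mul]; congr 1; field_simp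
  rwa [← inv_div (d : ℝ), inv_pow, ← div_eq_mul_inv, le_div_iff₀ (by positivity)]

theorem card_le_of_vcDim_le {F : Type*} {H : Set (F → Bool)} {d : ℕ} (hd : vcDim H ≤ d)
    {A : Finset F} (hA : Shatters H A) : A.card ≤ d := by
  have : (A.card : ℕ∞) ≤ d := (le_iSup₂_of_le A hA le_rfl).trans hd
  exact_mod_cast this

/-- The Sauer–Shelah bound for the labellings that `H` induces on a family of points `v`, which may
have repetitions. A labelling is encoded as the set of indices labelled `true`. -/
theorem exists_finset_restrictions {F ι : Type*} [Fintype ι] {H : Set (F → Bool)} {d : ℕ}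
    (hd : vcDim H ≤ d) (hdι : d ≤ Fintype.card ι) (v : ι → F) :
    ∃ T : Finset (Finset ι), (T.card : ℝ) ≤ Real.exp d * ((Fintype.card ι : ℝ) / d) ^ d ∧
      ∀ h ∈ H, ∃ A ∈ T, ∀ p, p ∈ A ↔ h (v p) = true := by
  classical
  let T : Finset (Finset ι) := {A | ∃ h ∈ H, ∀ p, p ∈ A ↔ h (v p) = true}
  have hT (A : Finset ι) : A ∈ T ↔ ∃ h ∈ H, ∀ p, p ∈ A ↔ h (v p) = true := by simp [T]
  refine ⟨T, ?_, fun h hh => ⟨Finset.univ.filter fun p => h (v p) = true, ?_, by simp⟩⟩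
  swap
  · exact (hT _).2 ⟨h, hh, by simp⟩
  have hvc : T.vcDim ≤ d := by
    refine Finset.sup_le fun s hs => ?_
    rw [Finset.mem_shatterer] at hs
    -- realisability of `{p}` for each `p ∈ s` makes `v` injective on `s`
    have hinj : Set.InjOn v s := by
      intro p hp q hq hpq
      obtain ⟨A, hA, hsA⟩ := hs.exists_inter_eq_singleton hp
      obtain ⟨h, -, hAh⟩ := (hT A).1 hA
      have hpA : p ∈ A := (Finset.mem_inter.1 (hsA ▸ Finset.mem_singleton_self p)).2
      have hqA : q ∈ A := by rw [hAh, ← hpq, ← hAh]; exact hpA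
      have : q ∈ s ∩ A := Finset.mem_inter.2 ⟨hq, hqA⟩
      rw [hsA, Finset.mem_singleton] at this
      exact this.symm
    rw [← Finset.card_image_of_injOn hinj]
    refine card_le_of_vcDim_le hd fun f => ?_
    obtain ⟨A, hA, hsA⟩ := hs (Finset.filter_subset (fun p => f (v p) = true) s)
    obtain ⟨h, hh, hAh⟩ := (hT A).1 hA
    refine ⟨h, hh, fun w hw => ?_⟩
    obtain ⟨p, hp, rfl⟩ := Finset.mem_image.1 hw
    have h1 : p ∈ s ∩ A ↔ p ∈ s.filter fun p => f (v p) = true := by rw [hsA]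
    rw [Finset.mem_inter, Finset.mem_filter, hAh] at h1
    simp only [Finset.mem_coe.1 hp, true_and] at h1
    exact Bool.eq_iff_iff.2 h1
  calc (T.card : ℝ) ≤ (∑ k ∈ Finset.Iic T.vcDim, (Fintype.card ι).choose k : ℕ) := by
        exact_mod_cast (Finset.card_le_card_shatterer T).trans Finset.card_shatterer_le_sum_vcDim
    _ ≤ (∑ k ∈ Finset.Iic d, (Fintype.card ι).choose k : ℕ) := by
        exact_mod_cast Finset.sum_le_sum_of_subset (Finset.Iic_subset_Iic.2 hvc)
    _ ≤ _ := sum_choose_le_exp_mul_div_pow hdι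

/-! ### Symmetrization with a ghost sample -/

/-- The number of sample points `w i` that lie in `L`, as a real number. -/
noncomputable def hits {Z β : Type*} [Fintype β] (L : Set Z) (w : β → Z) : ℝ :=
  ∑ i, L.indicator 1 (w i)

theorem measurable_hits {Z β : Type*} [Fintype β] [MeasurableSpace Z] {L : Set Z}
    (hL : MeasurableSet L) : Measurable (hits L : (β → Z) → ℝ) :=
  Finset.measurable_sum _ fun i _ =>
    (measurable_one.indicator hL).comp (measurable_pi_apply i)

theorem measurableSet_exists_mem_lt {ι Ω : Type*} [MeasurableSpace Ω] {s : Set ι}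
    (hs : s.Countable) {f : ι → Ω → ℝ} (hf : ∀ i ∈ s, Measurable (f i)) (c : ι → ℝ) :
    MeasurableSet {x | ∃ i ∈ s, c i < f i x} := by
  have : {x | ∃ i ∈ s, c i < f i x} = ⋃ i ∈ s, {x | c i < f i x} := by ext; simp
  rw [this]
  exact MeasurableSet.biUnion hs fun i hi => measurableSet_lt measurable_const (hf i hi)

theorem measureReal_hits_deviation_le {Z β : Type*} [Fintype β] [MeasurableSpace Z]
    (Q : Measure Z) [IsProbabilityMeasure Q] {L : Set Z} (hL : MeasurableSet L)
    {t : ℝ} (ht : 0 ≤ t) :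
    (Measure.pi fun _ : β => Q).real {w | Fintype.card β * t ≤ Fintype.card β * Q.real L - hits L w}
      ≤ Real.exp (-2 * Fintype.card β * t ^ 2) := by
  have h := measureReal_pi_le_exp_of_mem_Icc (fun _ : β => Q) (f := fun _ => L.indicator 1)
    (fun _ => measurable_one.indicator hL)
    (fun _ x => by by_cases hx : x ∈ L <;> simp [hx]) ht
  have hint : ∫ y, L.indicator (1 : Z → ℝ) y ∂Q = Q.real L := integral_indicator_one hL
  simpa [hint, hits, Finset.sum_sub_distrib] using h

/-- Comparison with a ghost sample `k` times as large as the sample: given a sample on which some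
`L` deviates by `ε`, the ghost frequency of this `L` falls below `Q L - a` with probability at most
`3 / 4`, and otherwise it exceeds the sample frequency by `ε - a`. -/
theorem measureReal_exists_deviation_le_ghost {Z β γ : Type*} [Fintype β] [Fintype γ]
    [MeasurableSpace Z]
    (Q : Measure Z) [IsProbabilityMeasure Q] {𝓛 : Set (Set Z)} (hc : 𝓛.Countable)
    (hm : ∀ L ∈ 𝓛, MeasurableSet L) {a : ℝ} (ha : 0 ≤ a) {ε k : ℝ} (hk : 0 ≤ k)
    (hcard : (Fintype.card γ : ℝ) = k * Fintype.card β)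
    (hgood : Real.exp (-2 * Fintype.card γ * a ^ 2) ≤ 3 / 4) :
    (Measure.pi fun _ : β => Q).real {S | ∃ L ∈ 𝓛, Fintype.card β * ε
        < Fintype.card β * Q.real L - hits L S} ≤
      4 * ((Measure.pi fun _ : β => Q).prod (Measure.pi fun _ : γ => Q)).real
        {x | ∃ L ∈ 𝓛, Fintype.card β * (k * (ε - a)) < hits L x.2 - k * hits L x.1} := by
  set A : Set (β → Z) := {S | ∃ L ∈ 𝓛, Fintype.card β * ε
        < Fintype.card β * Q.real L - hits L S} with hA
  set B : Set ((β → Z) × (γ → Z)) :=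
    {x | ∃ L ∈ 𝓛, Fintype.card β * (k * (ε - a)) < hits L x.2 - k * hits L x.1} with hB
  have hAm : MeasurableSet A := measurableSet_exists_mem_lt hc
    (fun L hL => measurable_const.sub (measurable_hits (hm L hL))) _
  have hBm : MeasurableSet B := measurableSet_exists_mem_lt hc
    (fun L hL => ((measurable_hits (hm L hL)).comp measurable_snd).sub
      (((measurable_hits (hm L hL)).comp measurable_fst).const_mul k)) _
  have hsec (S : β → Z) (hS : S ∈ A) :
      (1 / 4 : ℝ≥0∞) ≤ (Measure.pi fun _ : γ => Q) (Prod.mk S ⁻¹' B) := by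
    obtain ⟨L, hL, hlt⟩ := hS
    set D : Set (γ → Z) :=
      {w | Fintype.card γ * a ≤ Fintype.card γ * Q.real L - hits L w} with hD
    have hDm : MeasurableSet D := measurableSet_le measurable_const
      (measurable_const.sub (measurable_hits (hm L hL)))
    have hDle : (Measure.pi fun _ : γ => Q).real D ≤ 3 / 4 :=
      (measureReal_hits_deviation_le Q (hm L hL) ha).trans hgood
    have hDc : 1 / 4 ≤ (Measure.pi fun _ : γ => Q).real Dᶜ := by
      rw [probReal_compl_eq_one_sub hDm]; linarith
    have hsub : Dᶜ ⊆ Prod.mk S ⁻¹' B := by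
      intro w hw
      refine ⟨L, hL, ?_⟩
      simp only [hD, Set.mem_compl_iff, Set.mem_ofPred_eq, not_le, hcard] at hw
      have := mul_le_mul_of_nonneg_left hlt.le hk
      simp only
      linarith
    refine le_trans ?_ (measure_mono hsub)
    rw [← ofReal_measureReal]
    refine le_trans (le_of_eq ?_) (ENNReal.ofReal_le_ofReal hDc)
    rw [ENNReal.ofReal_div_of_pos (by norm_num)]
    simp
  have hmain : (1 / 4 : ℝ≥0∞) * (Measure.pi fun _ : β => Q) A ≤
      ((Measure.pi fun _ : β => Q).prod (Measure.pi fun _ : γ => Q)) B := by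
    rw [Measure.prod_apply hBm, ← setLIntegral_const]
    exact (setLIntegral_mono' hAm hsec).trans (setLIntegral_le_lintegral _ _)
  have h := ENNReal.toReal_mono (measure_ne_top _ _) hmain
  rw [ENNReal.toReal_mul] at h
  norm_num at h
  simp only [measureReal_def]
  linarith

/-- The uniform law on a finite type integrates to the arithmetic mean. -/
theorem integral_uniformOn_univ {κ : Type*} [Fintype κ] [Nonempty κ] [MeasurableSpace κ]
    [MeasurableSingletonClass κ] (f : κ → ℝ) :
    ∫ j, f j ∂(uniformOn (Set.univ : Set κ)) = (∑ j, f j) / Fintype.card κ := by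
  rw [integral_fintype Integrable.of_finite, Finset.sum_div]
  refine Finset.sum_congr rfl fun j _ => ?_
  have : (uniformOn (Set.univ : Set κ)).real {j} = (Fintype.card κ : ℝ)⁻¹ := by
    rw [measureReal_def, uniformOn_univ]
    simp
  rw [this, smul_eq_mul]
  field_simp

/-- For fixed points `z` arranged in blocks indexed by `β`, one point is chosen uniformly and
independently in each block. The chosen points deviate from all points with small probability,
simultaneously for all sets with traces in `T`, by Hoeffding's inequality for each trace. -/
theorem measureReal_exists_block_choice_le {Z β κ : Type*} [Fintype β] [Fintype κ] [Nonempty κ]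
    [MeasurableSpace κ] [MeasurableSingletonClass κ] {𝓛 : Set (Set Z)} (z : β × κ → Z)
    (T : Finset (Finset (β × κ))) (hT : ∀ L ∈ 𝓛, ∃ A ∈ T, ∀ p, p ∈ A ↔ z p ∈ L)
    {s : ℝ} (hs : 0 ≤ s) :
    (Measure.pi fun _ : β => uniformOn (Set.univ : Set κ)).real
        {τ | ∃ L ∈ 𝓛, Fintype.card β * s
          < hits L z / Fintype.card κ - hits L fun i => z (i, τ i)} ≤
      T.card * Real.exp (-2 * Fintype.card β * s ^ 2) := by
  classical
  have : IsProbabilityMeasure (uniformOn (Set.univ : Set κ)) :=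
    isProbabilityMeasure_uniformOn Set.finite_univ Set.univ_nonempty
  let f (A : Finset (β × κ)) (i : β) (j : κ) : ℝ := if (i, j) ∈ A then 1 else 0
  have hsub : {τ : β → κ | ∃ L ∈ 𝓛, Fintype.card β * s
        < hits L z / Fintype.card κ - hits L fun i => z (i, τ i)} ⊆
      ⋃ A ∈ T, {τ : β → κ | Fintype.card β * s
        ≤ ∑ i, (∫ j, f A i j ∂(uniformOn (Set.univ : Set κ)) - f A i (τ i))} := by
    rintro τ ⟨L, hL, hlt⟩
    obtain ⟨A, hA, hAL⟩ := hT L hL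
    refine Set.mem_biUnion hA (hlt.le.trans (le_of_eq ?_))
    simp only [integral_uniformOn_univ, Finset.sum_sub_distrib, hits, f, hAL, Set.indicator_apply,
      Fintype.sum_prod_type, Finset.sum_div, Pi.one_apply]
  calc _ ≤ (Measure.pi fun _ : β => uniformOn (Set.univ : Set κ)).real
        (⋃ A ∈ T, {τ : β → κ | Fintype.card β * s
        ≤ ∑ i, (∫ j, f A i j ∂(uniformOn (Set.univ : Set κ)) - f A i (τ i))}) :=
        measureReal_mono hsub (measure_ne_top _ _)
    _ ≤ ∑ A ∈ T, (Measure.pi fun _ : β => uniformOn (Set.univ : Set κ)).real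
        {τ : β → κ | Fintype.card β * s
        ≤ ∑ i, (∫ j, f A i j ∂(uniformOn (Set.univ : Set κ)) - f A i (τ i))} :=
        measureReal_biUnion_finset_le _ _
    _ ≤ ∑ A ∈ T, Real.exp (-2 * Fintype.card β * s ^ 2) :=
        Finset.sum_le_sum fun A _ => measureReal_pi_le_exp_of_mem_Icc _
          (fun i => measurable_of_finite _)
          (fun i j => by simp only [f]; split_ifs <;> simp) hs
    _ = _ := by rw [Finset.sum_const, nsmul_eq_mul]

/-- Relabelling the indices preserves the law of an i.i.d. sample. -/
theorem measurePreserving_comp_equiv {Z ι ι' : Type*} [Fintype ι] [Fintype ι'] [MeasurableSpace Z]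
    (Q : Measure Z) [IsProbabilityMeasure Q] (e : ι' ≃ ι) :
    MeasurePreserving (fun z : ι → Z => z ∘ e) (Measure.pi fun _ => Q) (Measure.pi fun _ => Q) := by
  have h := measurePreserving_piCongrLeft (α := fun _ : ι' => Z) (fun _ => Q) e.symm
  convert h using 1
  ext z i
  simp [MeasurableEquiv.coe_piCongrLeft, Equiv.piCongrLeft_apply]

theorem hits_comp_equiv {Z ι ι' : Type*} [Fintype ι] [Fintype ι'] (L : Set Z) (z : ι → Z)
    (e : ι' ≃ ι) : hits L (z ∘ e) = hits L z :=
  e.sum_comp fun p => L.indicator (1 : Z → ℝ) (z p)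

/-- For an i.i.d. family arranged in blocks, the point with index `j₀` in each block may be
exchanged with a uniformly random point of the block, so the bound for random choices applies. -/
theorem measureReal_exists_block_deviation_le {Z β κ : Type*} [Fintype β] [Fintype κ]
    [MeasurableSpace Z] (Q : Measure Z) [IsProbabilityMeasure Q] (j₀ : κ) {𝓛 : Set (Set Z)}
    (hc : 𝓛.Countable) (hm : ∀ L ∈ 𝓛, MeasurableSet L) {G : ℝ}
    (hG : ∀ z : β × κ → Z, ∃ T : Finset (Finset (β × κ)), (T.card : ℝ) ≤ G ∧
      ∀ L ∈ 𝓛, ∃ A ∈ T, ∀ p, p ∈ A ↔ z p ∈ L) {s : ℝ} (hs : 0 ≤ s) :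
    (Measure.pi fun _ : β × κ => Q).real {z | ∃ L ∈ 𝓛, Fintype.card β * s
          < hits L z / Fintype.card κ - hits L fun i => z (i, j₀)} ≤
      G * Real.exp (-2 * Fintype.card β * s ^ 2) := by
  classical
  let _ : MeasurableSpace κ := ⊤
  have : Nonempty κ := ⟨j₀⟩
  have : IsProbabilityMeasure (uniformOn (Set.univ : Set κ)) :=
    isProbabilityMeasure_uniformOn Set.finite_univ Set.univ_nonempty
  let M : Measure (β → κ) := Measure.pi fun _ : β => uniformOn (Set.univ : Set κ)
  let B (τ : β → κ) : Set (β × κ → Z) := {z | ∃ L ∈ 𝓛, Fintype.card β * s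
          < hits L z / Fintype.card κ - hits L fun i => z (i, τ i)}
  have hBm (τ : β → κ) : MeasurableSet (B τ) := measurableSet_exists_mem_lt hc
    (fun L hL => ((measurable_hits (hm L hL)).div_const _).sub
      ((measurable_hits (hm L hL)).comp
        (measurable_pi_lambda _ fun i => measurable_pi_apply _))) _
  have hBτ (τ : β → κ) : (Measure.pi fun _ : β × κ => Q) (B τ) =
      (Measure.pi fun _ : β × κ => Q) (B fun _ => j₀) := by
    -- the permutation that exchanges `j₀` and `τ i` in the block `i`
    let e : β × κ ≃ β × κ := Equiv.prodShear (Equiv.refl β) fun i => Equiv.swap j₀ (τ i)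
    rw [← (measurePreserving_comp_equiv Q e).measure_preimage (hBm fun _ => j₀).nullMeasurableSet]
    congr 1
    ext z
    simp only [B, Set.mem_preimage, Set.mem_ofPred_eq, hits_comp_equiv]
    simp [e]
  let J : Set ((β × κ → Z) × (β → κ)) := {x | x.1 ∈ B x.2}
  have hJm : MeasurableSet J := by
    have : J = ⋃ τ : β → κ, B τ ×ˢ {τ} := by
      ext ⟨z, τ⟩; simp [J]
    rw [this]
    exact MeasurableSet.iUnion fun τ => (hBm τ).prod (measurableSet_singleton τ)
  -- averaging over `τ` is Fubini's theorem for the pairs `(z, τ)`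
  have hJ : (Measure.pi fun _ : β × κ => Q) (B fun _ => j₀) =
      ((Measure.pi fun _ : β × κ => Q).prod M) J := by
    rw [Measure.prod_apply_symm hJm]
    have : ∀ τ, (Measure.pi fun _ : β × κ => Q) ((fun z => (z, τ)) ⁻¹' J) =
      (Measure.pi fun _ : β × κ => Q) (B fun _ => j₀) := fun τ => hBτ τ
    simp [this]
  have hle : ((Measure.pi fun _ : β × κ => Q).prod M) J ≤
      ENNReal.ofReal (G * Real.exp (-2 * Fintype.card β * s ^ 2)) := by
    rw [Measure.prod_apply hJm]
    refine (lintegral_mono (g := fun _ => ENNReal.ofReal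
      (G * Real.exp (-2 * Fintype.card β * s ^ 2))) fun z => ?_).trans (by simp)
    obtain ⟨T, hTG, hT⟩ := hG z
    rw [← ofReal_measureReal]
    refine ENNReal.ofReal_le_ofReal
      ((measureReal_exists_block_choice_le z T hT hs).trans ?_)
    gcongr
  have hG0 : 0 ≤ G := by
    obtain ⟨T, hTG, -⟩ := hG fun _ => (nonempty_of_isProbabilityMeasure Q).some
    exact (Nat.cast_nonneg _).trans hTG
  exact ENNReal.toReal_le_of_le_ofReal (by positivity) (hJ.trans_le hle)

/-- A sample indexed by `β` and a ghost sample indexed by `β × κ`, arranged in blocks: the index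
`none` of each block stands for its sample point. -/
def blockEquiv (β κ : Type*) : β ⊕ β × κ ≃ β × Option κ where
  toFun := Sum.elim (fun i => (i, none)) fun p => (p.1, some p.2)
  invFun p := p.2.elim (Sum.inl p.1) fun j => Sum.inr (p.1, j)
  left_inv := by rintro (i | ⟨i, j⟩) <;> rfl
  right_inv := by rintro ⟨i, _ | j⟩ <;> rfl

/-- The symmetrized tail bound for a countable class of sets with at most `G` traces on each family
of `(card κ + 1) * card β` points. A deviation `k (ε - a)` of the ghost sums from `k` times the
sample sums is a deviation `k / (k + 1) * (ε - a)` of the sample mean from the mean of all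
points. -/
theorem measureReal_exists_deviation_le {Z β κ : Type*} [Fintype β] [Fintype κ]
    [MeasurableSpace Z] (Q : Measure Z) [IsProbabilityMeasure Q] {𝓛 : Set (Set Z)}
    (hc : 𝓛.Countable) (hm : ∀ L ∈ 𝓛, MeasurableSet L) {G : ℝ}
    (hG : ∀ z : β × Option κ → Z, ∃ T : Finset (Finset (β × Option κ)), (T.card : ℝ) ≤ G ∧
      ∀ L ∈ 𝓛, ∃ A ∈ T, ∀ p, p ∈ A ↔ z p ∈ L) {a ε : ℝ} (ha : 0 ≤ a) (haε : a ≤ ε)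
    (hgood : Real.exp (-2 * (Fintype.card κ * Fintype.card β) * a ^ 2) ≤ 3 / 4) :
    (Measure.pi fun _ : β => Q).real {S | ∃ L ∈ 𝓛, Fintype.card β * ε
        < Fintype.card β * Q.real L - hits L S} ≤
      4 * (G * Real.exp (-2 * Fintype.card β *
        (Fintype.card κ / (Fintype.card κ + 1) * (ε - a)) ^ 2)) := by
  set k : ℝ := ((Fintype.card κ : ℕ) : ℝ) with hk
  have hk0 : 0 ≤ k := Nat.cast_nonneg _
  have hghost := measureReal_exists_deviation_le_ghost (β := β) (γ := β × κ) Q hc hm ha (ε := ε)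
    (k := k) hk0 (by simp [hk, mul_comm]) (by
      convert hgood using 3
      simp [hk, mul_comm])
  have hblock := measureReal_exists_block_deviation_le (β := β) Q (none : Option κ) hc hm hG
    (s := k / (k + 1) * (ε - a)) (mul_nonneg (by positivity) (sub_nonneg.2 haε))
  refine hghost.trans ?_
  gcongr
  refine le_trans (le_of_eq ?_) hblock
  have hψ := (measurePreserving_sumPiEquivProdPi
    (X := fun _ : β ⊕ β × κ => Z) fun _ => Q).comp
    (measurePreserving_comp_equiv Q (blockEquiv β κ))
  have hBm : MeasurableSet {x : (β → Z) × (β × κ → Z) | ∃ L ∈ 𝓛,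
      Fintype.card β * (k * (ε - a)) < hits L x.2 - k * hits L x.1} :=
    measurableSet_exists_mem_lt hc
      (fun L hL => ((measurable_hits (hm L hL)).comp measurable_snd).sub
        (((measurable_hits (hm L hL)).comp measurable_fst).const_mul k)) _
  simp only [measureReal_def]
  rw [← hψ.measure_preimage hBm.nullMeasurableSet]
  congr 2
  ext z
  simp only [Set.mem_preimage, Set.mem_ofPred_eq]
  refine exists_congr fun L => and_congr_right fun _ => ?_
  have h1 : hits L z =
      hits L (fun i => z (i, none)) + hits L fun p : β × κ => z (p.1, some p.2) := by
    rw [← hits_comp_equiv L z (blockEquiv β κ), hits, Fintype.sum_sum_type]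
    rfl
  have h2 : (Fintype.card (Option κ) : ℝ) = k + 1 := by simp [hk]
  rw [h1, h2, div_mul_eq_mul_div, ← mul_div_assoc, ← sub_pos, ← sub_pos (b := _ / _)]
  have h3 : ∀ x y : ℝ, (x + y) / (k + 1) - x - Fintype.card β * (k * (ε - a)) / (k + 1)
      = (y - k * x - Fintype.card β * (k * (ε - a))) / (k + 1) := fun x y => by
    field_simp; ring
  rw [h3, div_pos_iff_of_pos_right (by positivity)]
  rfl

/-! ### Numerical estimates -/

theorem mul_vcTerm_sq {d N : ℕ} (hN : 1 ≤ N) (hd : d ≤ 2 * N) {η : ℝ} (hη₀ : 0 < η)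
    (hη₁ : η < 1) : N * vcTerm d N η ^ 2 = 2 * d * Real.log (2 * N / d) + 2 * Real.log (4 / η) ∧
      0 ≤ d * Real.log (2 * N / d) ∧ 2 * Real.log 2 ≤ Real.log (4 / η) := by
  have hN' : (0 : ℝ) < N := by exact_mod_cast hN
  have h1 : 0 ≤ d * Real.log (2 * N / d) := by
    rcases Nat.eq_zero_or_pos d with rfl | h0
    · simp
    · refine mul_nonneg (Nat.cast_nonneg _) (Real.log_nonneg ?_)
      rw [le_div_iff₀ (by exact_mod_cast h0), one_mul]
      exact_mod_cast hd
  have h2 : 2 * Real.log 2 ≤ Real.log (4 / η) := by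
    rw [show (2 : ℝ) * Real.log 2 = Real.log 4 by
      rw [show (4 : ℝ) = 2 ^ 2 by norm_num, Real.log_pow]; norm_num]
    refine Real.log_le_log (by norm_num) ?_
    rw [le_div_iff₀ hη₀]; linarith
  have h3 := Real.log_pos one_lt_two
  refine ⟨?_, h1, h2⟩
  rw [vcTerm, Real.sq_sqrt (div_nonneg (by linarith) hN'.le)]
  field_simp

/-- On `[log 2, 2]` the convex function `exp x - 4 x` is negative, as it is so at the end points. -/
theorem two_le_of_four_mul_lt_exp {x : ℝ} (hx : Real.log 2 ≤ x) (h : 4 * x < Real.exp x) :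
    2 ≤ x := by
  by_contra! hx2
  have hl := Real.log_two_gt_d9
  have hl' := Real.log_two_lt_d9
  have he : Real.exp 2 ≤ 8 := by
    rw [show (2 : ℝ) = 1 + 1 by norm_num, Real.exp_add]
    nlinarith [Real.exp_one_lt_d9, Real.exp_pos 1]
  have hD : 0 < 2 - Real.log 2 := by linarith
  have ha : 0 ≤ (2 - x) / (2 - Real.log 2) := div_nonneg (by linarith) hD.le
  have hb : 0 ≤ (x - Real.log 2) / (2 - Real.log 2) := div_nonneg (by linarith) hD.le
  have hconv := convexOn_exp.2 (Set.mem_univ (Real.log 2)) (Set.mem_univ 2) ha hb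
    (by field_simp; ring)
  have hx' : (2 - x) / (2 - Real.log 2) * Real.log 2
      + (x - Real.log 2) / (2 - Real.log 2) * 2 = x := by
    field_simp; ring
  simp only [smul_eq_mul] at hconv
  rw [hx', Real.exp_log two_pos] at hconv
  nlinarith [mul_le_mul_of_nonneg_left he hb]

/-- The tail bound for `κ = Fin 7` and `a = ε / 8`, with Sauer's bound for the number of traces,
is at most `η` in the regime where the complexity term is nontrivial. -/
theorem vc_tail_le {d N : ℕ} (hN : 1 ≤ N) (hd : d ≤ N) {η : ℝ} (hη₀ : 0 < η) (hη₁ : η < 1)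
    (hε : vcTerm d N η < 1) :
    4 * (Real.exp d * ((8 * N : ℝ) / d) ^ d
      * Real.exp (-2 * N * (7 / 8 * (vcTerm d N η - vcTerm d N η / 8)) ^ 2)) ≤ η := by
  obtain ⟨hE, hL0, h4η⟩ := mul_vcTerm_sq hN (by omega : d ≤ 2 * N) hη₀ hη₁
  have hN' : (0 : ℝ) < N := by exact_mod_cast hN
  have hl := Real.log_two_gt_d9
  have hl' := Real.log_two_lt_d9
  set ε := vcTerm d N η with hεdef
  have hε0 : 0 ≤ ε := Real.sqrt_nonneg _
  have hη : η = 4 * Real.exp (-Real.log (4 / η)) := by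
    rw [Real.exp_neg, Real.exp_log (by positivity)]; field_simp
  have hexpo : -2 * N * (7 / 8 * (ε - ε / 8)) ^ 2 = -(2401 / 2048) * (N * ε ^ 2) := by ring
  rw [hexpo]
  conv_rhs => rw [hη]
  refine mul_le_mul_of_nonneg_left ?_ (by norm_num)
  rcases Nat.eq_zero_or_pos d with rfl | hd0
  · simp only [CharP.cast_eq_zero, Real.exp_zero, pow_zero, one_mul, Real.exp_le_exp]
    simp only [CharP.cast_eq_zero, mul_zero, zero_mul, zero_add] at hE
    rw [hE]; linarith
  have hd' : (0 : ℝ) < d := by exact_mod_cast hd0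
  -- `ε < 1` says `N > 2 d L`, that is `exp L > 4 L` with `L = log (2 N / d) ≥ log 2`
  set L := Real.log (2 * N / d) with hL
  have hexpL : Real.exp L = 2 * N / d := Real.exp_log (by positivity)
  have hεN : N * ε ^ 2 < N :=
    mul_lt_of_lt_one_right hN' (pow_lt_one₀ hε0 hε two_ne_zero)
  have hLN : 2 * d * L < N := by linarith
  have hL2 : 2 ≤ L := by
    refine two_le_of_four_mul_lt_exp ?_ ?_
    · refine Real.log_le_log two_pos ?_
      rw [le_div_iff₀ hd']
      have : (d : ℝ) ≤ N := by exact_mod_cast hd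
      linarith
    · rw [hexpL, lt_div_iff₀ hd']; linarith
  have h8 : ((8 * N : ℝ) / d) ^ d = Real.exp (d * (L + 2 * Real.log 2)) := by
    rw [Real.exp_nat_mul, Real.exp_add, hexpL, two_mul (Real.log 2), Real.exp_add,
      Real.exp_log two_pos]
    congr 1; ring
  rw [h8, ← Real.exp_add, ← Real.exp_add, Real.exp_le_exp, hE]
  nlinarith [mul_le_mul_of_nonneg_left hL2 hd'.le, mul_le_mul_of_nonneg_left hl'.le hd'.le]

/-- Each set has, with probability at least `1 / 4`, a ghost frequency not below its mean by
more than `ε / 8`. -/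
theorem ghost_tail_le {d N : ℕ} (hN : 1 ≤ N) (hd : d ≤ N) {η : ℝ} (hη₀ : 0 < η) (hη₁ : η < 1) :
    Real.exp (-2 * (7 * N) * (vcTerm d N η / 8) ^ 2) ≤ 3 / 4 := by
  obtain ⟨hE, hL0, h4η⟩ := mul_vcTerm_sq hN (by omega : d ≤ 2 * N) hη₀ hη₁
  have hl := Real.log_two_gt_d9
  rw [show (-2 * (7 * N) * (vcTerm d N η / 8) ^ 2 : ℝ) = -(7 / 32 * (N * vcTerm d N η ^ 2)) by ring,
    Real.exp_neg]
  refine inv_le_of_inv_le₀ (by norm_num) ?_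
  refine le_trans ?_ (Real.add_one_le_exp _)
  rw [hE]; linarith

/-! ### The risk of classifiers -/

/-- The set of labelled points misclassified by `h`. -/
def lossSet {X F : Type*} (φ : X → F) (h : F → Bool) : Set (X × Bool) :=
  {z | h (φ z.1) ≠ z.2}

theorem mul_empRisk {X F : Type*} {N : ℕ} (hN : 1 ≤ N) (φ : X → F) (S : Fin N → X × Bool)
    (h : F → Bool) : N * empRisk φ S h = hits (lossSet φ h) S := by
  have hN' : (N : ℝ) ≠ 0 := by exact_mod_cast (by omega : N ≠ 0)
  rw [empRisk, mul_div_cancel₀ _ hN', hits]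
  refine Finset.sum_congr rfl fun i _ => ?_
  simp [Set.indicator_apply, lossSet]

theorem empRisk_nonneg {X F : Type*} {N : ℕ} (φ : X → F) (S : Fin N → X × Bool)
    (h : F → Bool) : 0 ≤ empRisk φ S h :=
  div_nonneg (Finset.sum_nonneg fun i _ => by split_ifs <;> norm_num) (Nat.cast_nonneg _)

theorem optJointRisk_nonneg {X F : Type*} [MeasurableSpace X] (φ : X → F)
    (Qs Qt : Measure (X × Bool)) (H : Set (F → Bool)) : 0 ≤ optJointRisk φ Qs Qt H :=
  Real.iInf_nonneg fun _ => add_nonneg (risk_nonneg _ _ _) (risk_nonneg _ _ _)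

/-- The loss sets have no more traces than the class has labellings, since the loss of `h` at a
labelled point is determined by the label that `h` assigns. -/
theorem exists_finset_lossSet_traces {X F ι : Type*} [Fintype ι] {φ : X → F}
    {H : Set (F → Bool)} {d : ℕ} (hd : vcDim H ≤ d) (hdι : d ≤ Fintype.card ι)
    (z : ι → X × Bool) :
    ∃ T : Finset (Finset ι), (T.card : ℝ) ≤ Real.exp d * ((Fintype.card ι : ℝ) / d) ^ d ∧
      ∀ h ∈ H, ∃ A ∈ T, ∀ p, p ∈ A ↔ z p ∈ lossSet φ h := by
  classical
  obtain ⟨T, hT, hTH⟩ := exists_finset_restrictions hd hdι fun p => φ (z p).1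
  refine ⟨T.image fun A => Finset.univ.filter fun p => ¬(p ∈ A ↔ (z p).2 = true),
    (Nat.cast_le.2 Finset.card_image_le).trans hT, fun h hh => ?_⟩
  obtain ⟨A, hA, hAh⟩ := hTH h hh
  refine ⟨_, Finset.mem_image_of_mem _ hA, fun p => ?_⟩
  simp only [Finset.mem_filter, Finset.mem_univ, true_and, hAh]
  change _ ↔ h _ ≠ _
  exact not_congr Bool.eq_iff_iff.symm

theorem tendsto_risk {X F : Type*} [MeasurableSpace X] [MeasurableSpace F]
    {φ : X → F} (hφ : Measurable φ) (Q : Measure (X × Bool)) [IsProbabilityMeasure Q]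
    {h : F → Bool} {g : ℕ → F → Bool} (hg : ∀ n, Measurable (g n))
    (hlim : ∀ v, ∀ᶠ n in Filter.atTop, g n v = h v) :
    Filter.Tendsto (fun n => risk φ Q (g n)) Filter.atTop (nhds (risk φ Q h)) := by
  refine (ENNReal.tendsto_toReal (measure_ne_top Q _)).comp
    (tendsto_measure_of_tendsto_indicator_of_isFiniteMeasure (A := {z | h (φ z.1) ≠ z.2})
      Filter.atTop Q (fun n => measurableSet_ne_label hφ (hg n)) fun z => ?_)
  filter_upwards [hlim (φ z.1)] with n hn
  simp [hn]

theorem risk_le_of_pointwise_limit {X F : Type*} [MeasurableSpace X] [MeasurableSpace F]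
    {φ : X → F} (hφ : Measurable φ) (Q : Measure (X × Bool)) [IsProbabilityMeasure Q]
    {h : F → Bool} {g : ℕ → F → Bool} (hg : ∀ n, Measurable (g n))
    (hlim : ∀ v, ∀ᶠ n in Filter.atTop, g n v = h v) {N : ℕ} (S : Fin N → X × Bool) {ε : ℝ}
    (hle : ∀ n, risk φ Q (g n) ≤ empRisk φ S (g n) + ε) :
    risk φ Q h ≤ empRisk φ S h + ε := by
  refine le_of_tendsto (tendsto_risk hφ Q hg hlim) ?_
  filter_upwards [Filter.eventually_all.2 fun i => hlim (φ (S i).1)] with n hn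
  have : empRisk φ S (g n) = empRisk φ S h := by simp [empRisk, hn]
  exact this ▸ hle n

/-- Only subadditivity is used, so `s` need not be measurable. -/
theorem one_sub_le_measureReal_of_compl_subset {α : Type*} [MeasurableSpace α] {μ : Measure α}
    [IsProbabilityMeasure μ] {s t : Set α} {η : ℝ} (hst : sᶜ ⊆ t) (ht : μ.real t ≤ η) :
    1 - η ≤ μ.real s := by
  have hu : s ∪ t = Set.univ :=
    Set.eq_univ_of_forall fun x => (em (x ∈ s)).imp_right fun hx => hst hx
  have h1 : μ.real (s ∪ t) = 1 := by rw [hu, probReal_univ]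
  have := measureReal_union_le (μ := μ) s t
  linarith

/-! ### Generalization bounds -/

theorem measureReal_exists_risk_gap_le {X F : Type*} [MeasurableSpace X] [MeasurableSpace F]
    {φ : X → F} (hφ : Measurable φ) (Q : Measure (X × Bool)) [IsProbabilityMeasure Q]
    {H C : Set (F → Bool)} (hH : ∀ h ∈ H, Measurable h) (hCH : C ⊆ H) (hC : C.Countable)
    {d N : ℕ} (hvc : vcDim H ≤ d) (hN : 1 ≤ N) (hd : d ≤ N) {η : ℝ} (hη₀ : 0 < η) (hη₁ : η < 1)
    (hε : vcTerm d N η < 1) :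
    (Measure.pi fun _ : Fin N => Q).real
      {S | ∃ h ∈ C, empRisk φ S h + vcTerm d N η < risk φ Q h} ≤ η := by
  have hN' : (0 : ℝ) < N := by exact_mod_cast hN
  have hε0 : 0 ≤ vcTerm d N η := Real.sqrt_nonneg _
  have hcard : Fintype.card (Fin N × Option (Fin 7)) = N * 8 := by simp
  have h := measureReal_exists_deviation_le (β := Fin N) (κ := Fin 7) Q
    (𝓛 := lossSet φ '' C) (hC.image _)
    (by rintro _ ⟨h, hh, rfl⟩; exact measurableSet_ne_label hφ (hH h (hCH hh)))
    (G := Real.exp d * ((8 * N : ℝ) / d) ^ d)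
    (fun z => by
      obtain ⟨T, hT, hTH⟩ := exists_finset_lossSet_traces (φ := φ) hvc (by omega) z
      refine ⟨T, hT.trans_eq ?_, ?_⟩
      · rw [hcard]; push_cast; rw [mul_comm (N : ℝ)]
      · rintro _ ⟨h, hh, rfl⟩
        exact hTH h (hCH hh))
    (a := vcTerm d N η / 8) (ε := vcTerm d N η) (by positivity) (by linarith)
    (by simpa using ghost_tail_le hN hd hη₀ hη₁)
  refine le_trans (measureReal_mono ?_ (measure_ne_top _ _)) (h.trans ?_)
  · rintro S ⟨h, hh, hlt⟩
    refine ⟨_, ⟨h, hh, rfl⟩, ?_⟩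
    rw [← mul_empRisk hN, Fintype.card_fin]
    have := mul_lt_mul_of_pos_left hlt hN'
    change _ < N * risk φ Q h - _
    linarith
  · refine le_trans (le_of_eq ?_) (vc_tail_le hN hd hη₀ hη₁ hε)
    rw [Fintype.card_fin, Fintype.card_fin]
    norm_num

theorem measureReal_risk_gap_le {X F : Type*} [MeasurableSpace X] [MeasurableSpace F]
    {φ : X → F} (hφ : Measurable φ) (Q : Measure (X × Bool)) [IsProbabilityMeasure Q]
    {h : F → Bool} (hh : Measurable h)
    {d N : ℕ} (hN : 1 ≤ N) (hd : d ≤ 2 * N) {η : ℝ} (hη₀ : 0 < η) (hη₁ : η < 1) :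
    (Measure.pi fun _ : Fin N => Q).real {S | empRisk φ S h + vcTerm d N η < risk φ Q h} ≤ η := by
  have hN' : (0 : ℝ) < N := by exact_mod_cast hN
  obtain ⟨hE, hL0, h4η⟩ := mul_vcTerm_sq hN hd hη₀ hη₁
  have hl := Real.log_two_gt_d9
  have hdev := measureReal_hits_deviation_le (β := Fin N) Q (L := lossSet φ h)
    (measurableSet_ne_label hφ hh) (t := vcTerm d N η) (Real.sqrt_nonneg _)
  refine le_trans (measureReal_mono ?_ (measure_ne_top _ _)) (hdev.trans ?_)
  · intro S (hlt : _ < risk φ Q h)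
    have := mul_lt_mul_of_pos_left hlt hN'
    change _ ≤ _ * risk φ Q h - _
    rw [← mul_empRisk hN, Fintype.card_fin]
    linarith
  · rw [Fintype.card_fin, mul_assoc, hE]
    calc Real.exp (-2 * (2 * d * Real.log (2 * N / d) + 2 * Real.log (4 / η)))
        ≤ Real.exp (-Real.log (4 / η)) := Real.exp_le_exp.2 (by linarith)
      _ = η / 4 := by rw [Real.exp_neg, Real.exp_log (by positivity), inv_div]
      _ ≤ η := by linarith

end DomainShift

theorem mainTheorem1 {Ω X F : Type*} [MeasurableSpace X] [MeasurableSpace F]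
    (φ : X → F) (hφ : Measurable φ)
    (P : Ω → Measure (X × Bool)) [∀ ω, IsProbabilityMeasure (P ω)]
    (π : PMF Ω) (δ : ℝ≥0)
    (hδ : (⨆ ω, InformationTheory.klDiv (DomainShift.featureLaw φ (P ω))
      (DomainShift.featureMixture φ P π)) ≤ (δ : ℝ≥0∞))
    (H : Set (F → Bool)) (hH : ∀ h ∈ H, Measurable h)
    (d : ℕ) (hd : DomainShift.vcDim H = d)
    (ωs ωt : Ω) (N : ℕ) (hN : 1 ≤ N) (η : ℝ) (hη₀ : 0 < η) (hη₁ : η < 1) :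
    (d ≤ 2 * N → ∀ h ∈ H,
      1 - η ≤ (Measure.pi fun _ : Fin N => P ωs).real
        {S | DomainShift.risk φ (P ωt) h ≤ DomainShift.empRisk φ S h
          + DomainShift.vcTerm d N η + Real.sqrt (2 * δ)
          + DomainShift.optJointRisk φ (P ωs) (P ωt) H}) ∧
    (d ≤ N → DomainShift.PointwiseSeparable H →
      1 - η ≤ (Measure.pi fun _ : Fin N => P ωs).real
        {S | ∀ h ∈ H, DomainShift.risk φ (P ωt) h ≤ DomainShift.empRisk φ S h
          + DomainShift.vcTerm d N η + Real.sqrt (2 * δ)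
          + DomainShift.optJointRisk φ (P ωs) (P ωt) H}) := by
  have hbound (h : F → Bool) (hh : h ∈ H) := DomainShift.risk_target_le hφ P π hδ hH ωs ωt hh
  refine ⟨fun hdN h hh => ?_, fun hdN ⟨C, hCH, hC, hlim⟩ => ?_⟩
  · refine DomainShift.one_sub_le_measureReal_of_compl_subset (fun S hS => ?_)
      (DomainShift.measureReal_risk_gap_le hφ (P ωs) (hH h hh) hN hdN hη₀ hη₁)
    by_contra hS'
    have h1 : DomainShift.risk φ (P ωs) h
        ≤ DomainShift.empRisk φ S h + DomainShift.vcTerm d N η := not_lt.1 hS'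
    refine hS ?_
    change DomainShift.risk φ (P ωt) h ≤ _
    linarith [hbound h hh]
  -- no classifier has a risk above `1`, so the bound is void when the complexity term is `≥ 1`
  · rcases le_or_gt 1 (DomainShift.vcTerm d N η) with hε | hε
    · refine DomainShift.one_sub_le_measureReal_of_compl_subset (t := ∅) (fun S hS => ?_)
        (by simpa using hη₀.le)
      refine hS fun h _ => ?_
      have h1 := DomainShift.risk_le_one φ (P ωt) h
      have h2 := DomainShift.empRisk_nonneg φ S h
      have h3 := DomainShift.optJointRisk_nonneg φ (P ωs) (P ωt) H
      linarith [Real.sqrt_nonneg (2 * (δ : ℝ))]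
    · refine DomainShift.one_sub_le_measureReal_of_compl_subset (fun S hS => ?_)
        (DomainShift.measureReal_exists_risk_gap_le hφ (P ωs) hH hCH hC hd.le hN hdN hη₀ hη₁ hε)
      by_contra hS'
      refine hS fun h hh => ?_
      obtain ⟨g, hgC, hgh⟩ := hlim h hh
      have h1 := DomainShift.risk_le_of_pointwise_limit hφ (P ωs)
        (fun n => hH _ (hCH (hgC n))) hgh S (ε := DomainShift.vcTerm d N η)
        fun n => not_lt.1 fun hlt => hS' ⟨g n, hgC n, hlt⟩
      linarith [hbound h hh]
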